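/- Let $\mathsf{gr}$ be the category of finitely generated free groups and group homomorphisms, let $\mathcal{F}(\mathsf{gr};\mathbb{Z})$ be the abelian category of functors from $\mathsf{gr}$ to the category $\mathsf{Ab}$ of abelian groups, and let $\mathfrak{a}\in\mathcal{F}(\mathsf{gr};\mathbb{Z})$ be the abelianization functor $G\mapsto G/[G,G]$. For $F\in\mathcal{F}(\mathsf{gr};\mathbb{Z})$ and $n\in\mathbb{N}=\{0,1,2,\dots\}$, the $n$-th cross-effect of $F$ is the functor $\mathrm{cr}_nF:\mathsf{gr}^n\to\mathsf{Ab}$ defined by $$\mathrm{cr}_nF(G_1,\ldots,G_n)=\mathrm{Ker}\Big(F(G_1*\cdots*G_n)\to\bigoplus_{i=1}^nF(G_1*\cdots*\widehat{G_i}*\cdots*G_n)\Big),$$ where $*$ is the free product, the hat means that the factor is omitted, and the $i$-th component of the map is induced by the homomorphism which is trivial on $G_i$ and the identity on the other free factors (so $\mathrm{cr}_0F=F(\{1\})$). The functor $F$ is said to be polynomial of degree $d\in\mathbb{N}$ if $\mathrm{cr}_{d+1}F=0$ and $\mathrm{cr}_dF\neq 0$. Proposition. If $F\in\mathcal{F}(\mathsf{gr};\mathbb{Z})$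 is polynomial of degree $d$, then $$\mathrm{Ext}^i_{\mathcal{F}(\mathsf{gr};\mathbb{Z})}(\mathfrak{a},F)=0\quad\text{for all } i\geq d.$$ -/

import Mathlib

open CategoryTheory

universe u

/-- The property of a group of being free and finitely generated. -/
def isFGFree : ObjectProperty GrpCat.{u} := fun G => IsFreeGroup G ∧ Group.FG G

/-- The category `gr` of finitely generated free groups and group homomorphisms. -/
abbrev Gr : Type (u + 1) := isFGFree.{u}.FullSubcategory

/-- The category `F(gr; ℤ)` of functors from `gr` to abelian groups. -/
abbrev FunctorsOnGr : Type (u + 1) := Gr.{u} ⥤ AddCommGrpCat.{u}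

/-- Ext-groups in `F(gr; ℤ)` (Yoneda Ext-groups, computed in the derived category). -/
instance : HasExt.{u + 1} FunctorsOnGr.{u} := HasExt.standard _

/-- The abelianization functor `𝔞 : gr ⥤ Ab`, `G ↦ G/[G, G]`. -/
def abelianizationFunctor : FunctorsOnGr.{u} :=
  isFGFree.ι ⋙ GrpCat.abelianize ⋙ CommGrpCat.toAddCommGrp

theorem fg_coprodI {ι : Type} [Finite ι] (G : ι → Type u) [∀ i, Group (G i)]
    (h : ∀ i, Group.FG (G i)) : Group.FG (Monoid.CoprodI G) := by
  rw [Group.fg_def]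
  have e : (⊤ : Subgroup (Monoid.CoprodI G)) =
      ⨆ i, (Monoid.CoprodI.of : G i →* Monoid.CoprodI G).range := by
    rw [← Monoid.CoprodI.range_eq_iSup (f := fun i => Monoid.CoprodI.of)]
    have : Monoid.CoprodI.lift (fun i => (Monoid.CoprodI.of : G i →* Monoid.CoprodI G)) =
        MonoidHom.id _ := by
      ext i x
      simp
    rw [this]
    exact (MonoidHom.range_eq_top.2 Function.surjective_id).symm
  rw [e]
  refine Subgroup.FG.iSup _ fun i => ?_
  have := h i
  exact (Group.fg_iff_subgroup_fg _).1 (Group.fg_range _)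

/-- The free product of a finite family of objects of `gr`. -/
def freeProd {ι : Type} [Finite ι] (G : ι → Gr.{u}) : Gr.{u} where
  obj := GrpCat.of (Monoid.CoprodI fun i => (G i).obj)
  property := by
    have h₁ : ∀ i, IsFreeGroup (G i).obj := fun i => (G i).property.1
    exact ⟨inferInstanceAs (IsFreeGroup (Monoid.CoprodI fun i => (G i).obj)),
      fg_coprodI _ fun i => (G i).property.2⟩

/-- The canonical morphism from a free factor to the free product. -/
def freeProdIncl {ι : Type} [Finite ι] (G : ι → Gr.{u}) (i : ι) : G i ⟶ freeProd G :=
  ObjectProperty.homMk (GrpCat.ofHom (Monoid.CoprodI.of (M := fun i => (G i).obj)))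

/-- The morphism from a free product which is `f i` on the free factor `G i`. -/
def freeProdDesc {ι : Type} [Finite ι] {G : ι → Gr.{u}} {K : Gr.{u}} (f : ∀ i, G i ⟶ K) :
    freeProd G ⟶ K :=
  ObjectProperty.homMk (GrpCat.ofHom (Monoid.CoprodI.lift fun i => (f i).hom.hom))

theorem freeProdIncl_desc {ι : Type} [Finite ι] {G : ι → Gr.{u}} {K : Gr.{u}}
    (f : ∀ i, G i ⟶ K) (i : ι) : freeProdIncl G i ≫ freeProdDesc f = f i := by
  apply ObjectProperty.hom_ext
  apply GrpCat.hom_ext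
  ext x
  exact Monoid.CoprodI.lift_of _ _

theorem freeProd_hom_ext {ι : Type} [Finite ι] {G : ι → Gr.{u}} {K : Gr.{u}}
    {f g : freeProd G ⟶ K} (h : ∀ i, freeProdIncl G i ≫ f = freeProdIncl G i ≫ g) : f = g := by
  apply ObjectProperty.hom_ext
  apply GrpCat.hom_ext
  apply Monoid.CoprodI.ext_hom
  intro i
  exact congrArg (fun φ => φ.hom.hom) (h i)

/-- The trivial homomorphism, which sends every element to the identity. -/
def trivialHom (G H : Gr.{u}) : G ⟶ H :=
  ObjectProperty.homMk (GrpCat.ofHom 1)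

theorem trivialHom_comp {G H K : Gr.{u}} (f : H ⟶ K) :
    trivialHom G H ≫ f = trivialHom G K := by
  apply ObjectProperty.hom_ext
  apply GrpCat.hom_ext
  ext x
  exact map_one f.hom.hom

theorem comp_trivialHom {G H K : Gr.{u}} (f : G ⟶ H) :
    f ≫ trivialHom H K = trivialHom G K := rfl

/-- The free product of a finite family of morphisms of `gr`. -/
def freeProdMap {ι : Type} [Finite ι] {G H : ι → Gr.{u}} (f : ∀ i, G i ⟶ H i) :
    freeProd G ⟶ freeProd H :=
  freeProdDesc fun i => f i ≫ freeProdIncl H i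

/-- The morphism `G₁ ∗ ⋯ ∗ Gₙ ⟶ G₁ ∗ ⋯ ∗ Ĝᵢ ∗ ⋯ ∗ Gₙ` which is trivial on `Gᵢ` and the
identity on the other free factors. -/
def freeProdOmit {n : ℕ} (G : Fin n → Gr.{u}) (i : Fin n) :
    freeProd G ⟶ freeProd (fun j : {j : Fin n // j ≠ i} => G j) :=
  freeProdDesc fun j =>
    if h : j = i then trivialHom _ _
    else freeProdIncl (fun k : {k : Fin n // k ≠ i} => G k) ⟨j, h⟩

theorem freeProdMap_id {ι : Type} [Finite ι] (G : ι → Gr.{u}) :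
    freeProdMap (fun i => 𝟙 (G i)) = 𝟙 (freeProd G) := by
  refine freeProd_hom_ext fun i => ?_
  rw [freeProdMap, freeProdIncl_desc, Category.id_comp, Category.comp_id]

theorem freeProdMap_comp {ι : Type} [Finite ι] {G H K : ι → Gr.{u}} (f : ∀ i, G i ⟶ H i)
    (g : ∀ i, H i ⟶ K i) :
    freeProdMap (fun i => f i ≫ g i) = freeProdMap f ≫ freeProdMap g := by
  refine freeProd_hom_ext fun i => ?_
  simp only [freeProdMap]
  rw [freeProdIncl_desc, ← Category.assoc, freeProdIncl_desc, Category.assoc, Category.assoc,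
    freeProdIncl_desc]

theorem freeProdMap_omit {n : ℕ} {G H : Fin n → Gr.{u}} (f : ∀ i, G i ⟶ H i) (i : Fin n) :
    freeProdMap f ≫ freeProdOmit H i =
      freeProdOmit G i ≫ freeProdMap (fun j : {j : Fin n // j ≠ i} => f j) := by
  refine freeProd_hom_ext fun j => ?_
  simp only [freeProdMap, freeProdOmit]
  rw [← Category.assoc, freeProdIncl_desc, Category.assoc, freeProdIncl_desc, ← Category.assoc,
    freeProdIncl_desc]
  by_cases h : j = i
  · rw [dif_pos h, dif_pos h, trivialHom_comp, comp_trivialHom]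
  · rw [dif_neg h, dif_neg h, freeProdIncl_desc]

/-- The subgroup
`cr_n F(G₁, …, Gₙ) = Ker (F(G₁ ∗ ⋯ ∗ Gₙ) ⟶ ⨁ᵢ F(G₁ ∗ ⋯ ∗ Ĝᵢ ∗ ⋯ ∗ Gₙ))`. -/
def crossEffectSubgroup (F : FunctorsOnGr.{u}) {n : ℕ} (G : Fin n → Gr.{u}) :
    AddSubgroup (F.obj (freeProd G)) :=
  (AddMonoidHom.pi fun i : Fin n => (F.map (freeProdOmit G i)).hom).ker

theorem map_mem_crossEffectSubgroup (F : FunctorsOnGr.{u}) {n : ℕ} {G H : Fin n → Gr.{u}}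
    (f : ∀ i, G i ⟶ H i) (x : F.obj (freeProd G)) (hx : x ∈ crossEffectSubgroup F G) :
    (F.map (freeProdMap f)).hom x ∈ crossEffectSubgroup F H := by
  funext i
  have hi : (F.map (freeProdOmit G i)).hom x = 0 := congrFun hx i
  change (F.map (freeProdOmit H i)).hom ((F.map (freeProdMap f)).hom x) = 0
  have e := congrArg (fun φ => (F.map φ).hom x) (freeProdMap_omit f i)
  simp only [Functor.map_comp, AddCommGrpCat.hom_comp, AddMonoidHom.comp_apply] at e
  rw [e, hi, map_zero]

/-- The `n`-th cross-effect functor `cr_n F : grⁿ ⥤ Ab`. -/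
def crossEffect (F : FunctorsOnGr.{u}) (n : ℕ) : (Fin n → Gr.{u}) ⥤ AddCommGrpCat.{u} where
  obj G := AddCommGrpCat.of (crossEffectSubgroup F G)
  map {G H} f := AddCommGrpCat.ofHom
    (((F.map (freeProdMap f)).hom.comp (crossEffectSubgroup F G).subtype).codRestrict
      (crossEffectSubgroup F H) fun x => map_mem_crossEffectSubgroup F f x.1 x.2)
  map_id G := by
    ext x
    change (F.map (freeProdMap fun i => 𝟙 (G i))).hom x.1 = x.1
    rw [freeProdMap_id]
    simp
  map_comp {G H K} f g := by
    ext x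
    change (F.map (freeProdMap fun i => f i ≫ g i)).hom x.1 =
      (F.map (freeProdMap g)).hom ((F.map (freeProdMap f)).hom x.1)
    rw [freeProdMap_comp]
    simp

/-- `F` is polynomial of degree `d`: `cr_{d+1} F = 0` and `cr_d F ≠ 0`. -/
def IsPolynomialOfDegree (F : FunctorsOnGr.{u}) (d : ℕ) : Prop :=
  Limits.IsZero (crossEffect F (d + 1)) ∧ ¬ Limits.IsZero (crossEffect F d)

/-! ### Crossed homomorphisms on free groups -/

/-! Write I(G) for the augmentation ideal of ℤ[G]. The functors X_n = I^{⊗(n+1)} with the bar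
differential, augmented by I → I/I² = 𝔞, form a projective resolution of 𝔞, and Hom(X_i, F) embeds
in cr_{i+1} F(ℤ, …, ℤ). This vanishes for i ≥ d, and Extⁱ(𝔞, F) is a subquotient of Hom(X_i, F).

Exactness is checked on each free group, where the bar complex computes group homology, which is
zero above degree 1. Concretely, I(G) is free as a left module on the elements g - 1 for the
generators g; equivalently, crossed homomorphisms can be prescribed on generators. One well-chosen
crossed homomorphism gives a contraction (`exists_bar_contraction`, `d_homotopy_sub`). The
contraction depends on a basis and is not natural, which is harmless since exactness is a pointwise
condition.

Projectivity: X_n is a retract of G ↦ ℤ[Gⁿ⁺¹] (`retractBarFunctor`), which is projective by the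
Yoneda lemma. The retraction sends a tuple to ⊗(g_k - 1), which is zero as soon as one g_k is
trivial; hence a morphism X_i → F yields an element of the cross-effect (`barFunctor_hom_eq_zero`).
-/

theorem IsFreeGroup.mem_subgroup_of_forall_of_mem {G : Type u} [Group G] [IsFreeGroup G]
    (S : Subgroup G) (h : ∀ j : IsFreeGroup.Generators G, IsFreeGroup.of j ∈ S) (g : G) :
    g ∈ S := by
  have e : S.subtype.comp (IsFreeGroup.lift fun j => (⟨IsFreeGroup.of j, h j⟩ : S)) =
      MonoidHom.id G := by
    refine IsFreeGroup.ext_hom fun j => ?_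
    simp
  have := DFunLike.congr_fun e g
  rw [MonoidHom.id_apply] at this
  rw [← this]
  exact Subtype.property _

/-- A crossed homomorphism on a free group can be prescribed on the generators. -/
theorem IsFreeGroup.exists_crossedHom {G : Type u} [Group G] [IsFreeGroup G] {N : Type*}
    [AddCommGroup N] (φ : G →* AddMonoid.End N) (b : IsFreeGroup.Generators G → N) :
    ∃ D : G → N, (∀ g h, D (g * h) = D g + φ g (D h)) ∧ ∀ j, D (IsFreeGroup.of j) = b j := by
  let ψ : G →* MulAut (Multiplicative N) :=
    { toFun := fun g => MonoidHom.toMulEquiv (φ g).toMultiplicative (φ g⁻¹).toMultiplicative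
        (by
          ext n
          change (φ g⁻¹ * φ g) n = n
          rw [← map_mul, inv_mul_cancel, map_one]
          rfl)
        (by
          ext n
          change (φ g * φ g⁻¹) n = n
          rw [← map_mul, mul_inv_cancel, map_one]
          rfl)
      map_one' := by
        ext n
        change φ 1 n = n
        rw [map_one]
        rfl
      map_mul' := fun g h => by
        ext n
        change φ (g * h) n = φ g (φ h n)
        rw [map_mul]
        rfl }
  -- Crossed homomorphisms G → N are the homomorphic sections of N ⋊ G → G, and a homomorphism out
  -- of a free group is given by its values on generators.
  let Ψ : G →* Multiplicative N ⋊[ψ] G :=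
    IsFreeGroup.lift fun j => ⟨Multiplicative.ofAdd (b j), IsFreeGroup.of j⟩
  have hΨ : SemidirectProduct.rightHom.comp Ψ = MonoidHom.id G := by
    refine IsFreeGroup.ext_hom fun j => ?_
    simp [Ψ]
  refine ⟨fun g => (Ψ g).left.toAdd, fun g h => ?_, fun j => ?_⟩
  · have hg : (Ψ g).right = g := DFunLike.congr_fun hΨ g
    change (Ψ (g * h)).left.toAdd = (Ψ g).left.toAdd + (ψ g (Ψ h).left).toAdd
    rw [map_mul, SemidirectProduct.mul_left, toAdd_mul, hg]
  · simp [Ψ]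

/-! ### Tensor powers of a nonunital ring and the bar complex -/

section Bar

variable {R : Type u} [NonUnitalRing R]

/-- The tensor power `R ⊗ ⋯ ⊗ R` with `n + 1` factors. -/
noncomputable def barPow (R : Type u) [NonUnitalRing R] : ℕ → AddCommGrpCat.{u}
  | 0 => AddCommGrpCat.of R
  | n + 1 => AddCommGrpCat.of (TensorProduct ℤ R (barPow R n))

namespace barPow

/-- The identification of `R` with its first tensor power. -/
def base : R →+ barPow R 0 := AddMonoidHom.id R

/-- The map `x, t ↦ x ⊗ t`. -/
noncomputable def cons (n : ℕ) : R →+ barPow R n →+ barPow R (n + 1) :=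
  AddMonoidHom.mk' (fun x => AddMonoidHom.mk' (fun t => TensorProduct.tmul ℤ x t)
    fun _ _ => TensorProduct.tmul_add _ _ _) fun x y => by
      ext t
      exact TensorProduct.add_tmul x y t

/-- The universal property of `barPow R (n + 1)`. -/
noncomputable def lift {n : ℕ} {M : Type*} [AddCommGroup M] (f : R →+ barPow R n →+ M) :
    barPow R (n + 1) →+ M :=
  TensorProduct.liftAddHom f fun r x t => by
    rw [map_zsmul, map_zsmul, AddMonoidHom.zsmul_apply]

@[simp]
theorem lift_cons {n : ℕ} {M : Type*} [AddCommGroup M] (f : R →+ barPow R n →+ M) (x : R)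
    (t : barPow R n) : lift f (cons n x t) = f x t := rfl

theorem hom_ext {n : ℕ} {M : Type*} [AddCommGroup M] {f g : barPow R (n + 1) →+ M}
    (h : ∀ x t, f (cons n x t) = g (cons n x t)) : f = g := by
  ext t
  induction t using TensorProduct.induction_on with
  | zero => exact (map_zero f).trans (map_zero g).symm
  | tmul x t => exact h x t
  | add t t' ht ht' => exact ((map_add f _ _).trans (by rw [ht, ht'])).trans (map_add g _ _).symm

theorem base_hom_ext {M : Type*} [AddCommGroup M] {f g : barPow R 0 →+ M}
    (h : ∀ x, f (base x) = g (base x)) : f = g :=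
  AddMonoidHom.ext h

/-- The left action of `R` on the first tensor factor. -/
noncomputable def act : ∀ n : ℕ, R →+ barPow R n →+ barPow R n
  | 0 => (AddMonoidHom.mul : R →+ R →+ R)
  | n + 1 => AddMonoidHom.mk' (fun x => lift ((cons n).comp (AddMonoidHom.mulLeft x)))
      fun x y => hom_ext fun z t => by simp [add_mul]

@[simp]
theorem act_base (x y : R) : act 0 x (base y) = base (x * y) := rfl

@[simp]
theorem act_cons (n : ℕ) (x y : R) (t : barPow R n) :
    act (n + 1) x (cons n y t) = cons n (x * y) t := rfl

theorem act_mul (n : ℕ) (x y : R) (t : barPow R n) : act n (x * y) t = act n x (act n y t) := by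
  suffices h : act n (x * y) = (act n x).comp (act n y) from DFunLike.congr_fun h t
  cases n with
  | zero => exact base_hom_ext fun z => by simp [mul_assoc]
  | succ n => exact hom_ext fun z t => by simp [mul_assoc]

/-- The differential of the bar complex. -/
noncomputable def d : ∀ n : ℕ, barPow R (n + 1) →+ barPow R n
  | 0 => lift (act 0)
  | n + 1 => lift (AddMonoidHom.mk' (fun x => act (n + 1) x - (cons n x).comp (d n))
      fun x y => by
        ext t
        simp only [map_add, AddMonoidHom.add_apply, AddMonoidHom.sub_apply,
          AddMonoidHom.comp_apply]
        abel)

@[simp]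
theorem d_zero_cons (x : R) (t : barPow R 0) : d 0 (cons 0 x t) = act 0 x t := rfl

@[simp]
theorem d_succ_cons (n : ℕ) (x : R) (t : barPow R (n + 1)) :
    d (n + 1) (cons (n + 1) x t) = act (n + 1) x t - cons n x (d n t) := rfl

/-- The differential is left `R`-linear: by associativity, multiplying into the first factor
commutes with contracting adjacent factors. Both d² = 0 and the contraction rest on this. -/
theorem d_act (n : ℕ) (x : R) (t : barPow R (n + 1)) :
    d n (act (n + 1) x t) = act n x (d n t) := by
  suffices h : (d n).comp (act (n + 1) x) = (act n x).comp (d n) from DFunLike.congr_fun h t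
  refine hom_ext fun y t => ?_
  cases n with
  | zero => simp [act_mul]
  | succ n => simp [act_mul]

theorem d_comp_d (n : ℕ) : (d n).comp (d (n + 1)) = (0 : barPow R (n + 2) →+ barPow R n) := by
  induction n with
  | zero => exact hom_ext fun x t => by simp [d_act]
  | succ n ih =>
    refine hom_ext fun x t => ?_
    have := DFunLike.congr_fun ih t
    simp only [AddMonoidHom.comp_apply, AddMonoidHom.zero_apply] at this
    simp [d_act, this]

/-- The homotopy of the bar complex which applies `σ` to the last tensor factor. -/
noncomputable def homotopy (σ : R →+ barPow R 1) : ∀ n : ℕ, barPow R n →+ barPow R (n + 1)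
  | 0 => σ
  | n + 1 => lift (AddMonoidHom.mk' (fun x => (cons (n + 1) x).comp (homotopy σ n))
      fun x y => by
        ext t
        simp)

@[simp]
theorem homotopy_base (σ : R →+ barPow R 1) (x : R) : homotopy σ 0 (base x) = σ x := rfl

@[simp]
theorem homotopy_cons (σ : R →+ barPow R 1) (n : ℕ) (x : R) (t : barPow R n) :
    homotopy σ (n + 1) (cons n x t) = cons (n + 1) x (homotopy σ n t) := rfl

/-- With at least two tensor factors, the action touches the first and the homotopy the last, so
they commute. With one factor they collide, and the hypothesis on σ(xy) in `d_homotopy_sub` measures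
the failure. -/
theorem homotopy_act (σ : R →+ barPow R 1) (n : ℕ) (x : R) (t : barPow R (n + 1)) :
    homotopy σ (n + 1) (act (n + 1) x t) = act (n + 2) x (homotopy σ (n + 1) t) := by
  suffices h : (homotopy σ (n + 1)).comp (act (n + 1) x) =
    (act (n + 2) x).comp (homotopy σ (n + 1)) from DFunLike.congr_fun h t
  exact hom_ext fun y t => by simp

/-- On x ⊗ y the terms xσ(y) cancel, and the two occurrences of x ⊗ l(y) cancel as well, leaving -x
⊗ y. Each further factor on the left passes through with one sign change, because d(x ⊗ t) contains
-x ⊗ d(t). -/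
theorem d_homotopy_sub {σ : R →+ barPow R 1} {l : R →+ R} (hd : ∀ x, d 0 (σ x) = base (x - l x))
    (hσ : ∀ x y, σ (x * y) = act 1 x (σ y) + cons 0 x (base (l y))) (n : ℕ)
    (t : barPow R (n + 1)) :
    d (n + 1) (homotopy σ (n + 1) t) - homotopy σ n (d n t) = (-1 : ℤ) ^ (n + 1) • t := by
  suffices h : (d (n + 1)).comp (homotopy σ (n + 1)) - (homotopy σ n).comp (d n) =
      (-1 : ℤ) ^ (n + 1) • AddMonoidHom.id (barPow R (n + 1)) from DFunLike.congr_fun h t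
  clear t
  induction n with
  | zero =>
    refine hom_ext fun x t => ?_
    obtain ⟨y, rfl⟩ : ∃ y, base y = t := ⟨t, rfl⟩
    change _ = (-1 : ℤ) ^ (0 + 1) • cons 0 x (base y)
    simp only [AddMonoidHom.sub_apply, AddMonoidHom.comp_apply, homotopy_cons, homotopy_base,
      d_succ_cons, hd, d_zero_cons, act_base, hσ, map_sub, zero_add, pow_one, neg_smul, one_smul]
    abel
  | succ n ih =>
    refine hom_ext fun x t => ?_
    have := congrArg (cons (n + 1) x) (DFunLike.congr_fun ih t)
    simp only [AddMonoidHom.sub_apply, AddMonoidHom.comp_apply, map_sub,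
      AddMonoidHom.zsmul_apply, AddMonoidHom.id_apply, map_zsmul] at this
    simp only [AddMonoidHom.sub_apply, AddMonoidHom.comp_apply, homotopy_cons, d_succ_cons,
      map_sub, AddMonoidHom.zsmul_apply, AddMonoidHom.id_apply, homotopy_act]
    rw [pow_succ, mul_neg_one, neg_smul, ← this]
    abel

theorem exists_d_eq {σ : R →+ barPow R 1} {l : R →+ R} (hd : ∀ x, d 0 (σ x) = base (x - l x))
    (hσ : ∀ x y, σ (x * y) = act 1 x (σ y) + cons 0 x (base (l y))) (n : ℕ)
    (t : barPow R (n + 1)) (ht : d n t = 0) : ∃ t', d (n + 1) t' = t := by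
  have := d_homotopy_sub hd hσ n t
  rw [ht, map_zero, sub_zero] at this
  refine ⟨(-1 : ℤ) ^ (n + 1) • homotopy σ (n + 1) t, ?_⟩
  rw [map_zsmul, this, smul_smul, ← mul_pow]
  simp

/-- The map induced on tensor powers by a homomorphism of nonunital rings. -/
noncomputable def map {S : Type u} [NonUnitalRing S] (f : R →ₙ+* S) :
    ∀ n : ℕ, barPow R n →+ barPow S n
  | 0 => (f : R →+ S)
  | n + 1 => lift (AddMonoidHom.mk' (fun x => (cons n (f x)).comp (map f n)) fun x y => by
      ext t
      simp)

variable {S : Type u} [NonUnitalRing S] (f : R →ₙ+* S)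

@[simp]
theorem map_base (x : R) : map f 0 (base x) = base (f x) := rfl

@[simp]
theorem map_cons (n : ℕ) (x : R) (t : barPow R n) :
    map f (n + 1) (cons n x t) = cons n (f x) (map f n t) := rfl

theorem map_id (n : ℕ) : map (NonUnitalRingHom.id R) n = AddMonoidHom.id _ := by
  induction n with
  | zero => rfl
  | succ n ih => exact hom_ext fun x t => by simp [ih]

theorem map_comp {T : Type u} [NonUnitalRing T] (g : S →ₙ+* T) (n : ℕ) :
    map (g.comp f) n = (map g n).comp (map f n) := by
  induction n with
  | zero => rfl
  | succ n ih => exact hom_ext fun x t => by simp [ih]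

theorem map_act (n : ℕ) (x : R) (t : barPow R n) :
    map f n (act n x t) = act n (f x) (map f n t) := by
  suffices h : (map f n).comp (act n x) = (act n (f x)).comp (map f n) from
    DFunLike.congr_fun h t
  cases n with
  | zero => exact base_hom_ext fun y => by simp
  | succ n => exact hom_ext fun y t => by simp

theorem map_d (n : ℕ) (t : barPow R (n + 1)) : map f n (d n t) = d n (map f (n + 1) t) := by
  suffices h : (map f n).comp (d n) = (d n).comp (map f (n + 1)) from DFunLike.congr_fun h t
  clear t
  induction n with
  | zero => exact hom_ext fun x t => by simp [map_act]
  | succ n ih =>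
    refine hom_ext fun x t => ?_
    have := DFunLike.congr_fun ih t
    simp only [AddMonoidHom.comp_apply] at this
    simp only [AddMonoidHom.comp_apply, d_succ_cons, map_cons, map_sub, map_act, this]

end barPow

end Bar

/-! ### The augmentation ideal of a free group -/

section Augmentation

variable {G : Type u} [Group G]

/-- The augmentation `ℤ[G] → ℤ`. -/
def augmentation (G : Type u) [Group G] : FreeAbelianGroup G →+* ℤ :=
  FreeAbelianGroup.liftMonoid 1

@[simp]
theorem augmentation_of (g : G) : augmentation G (FreeAbelianGroup.of g) = 1 := by
  simp [augmentation]

/-- The augmentation ideal of `ℤ[G]`, as a nonunital ring. -/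
def augIdeal (G : Type u) [Group G] : NonUnitalSubring (FreeAbelianGroup G) where
  carrier := {x | augmentation G x = 0}
  add_mem' {x y} hx hy := by
    simp only [Set.mem_ofPred_eq] at *
    rw [map_add, hx, hy, add_zero]
  zero_mem' := map_zero _
  neg_mem' {x} hx := by
    simp only [Set.mem_ofPred_eq] at *
    rw [map_neg, hx, neg_zero]
  mul_mem' {x y} hx hy := by
    simp only [Set.mem_ofPred_eq] at *
    rw [map_mul, hx, zero_mul]

theorem augmentation_coe (x : augIdeal G) : augmentation G x = 0 := x.2

/-- The projection `x ↦ x - ε(x)` of `ℤ[G]` onto its augmentation ideal. -/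
def augProj (G : Type u) [Group G] : FreeAbelianGroup G →+ augIdeal G :=
  AddMonoidHom.mk' (fun x => ⟨x - (augmentation G x : ℤ), by
    change augmentation G _ = 0
    simp⟩) fun x y => by
      ext
      change x + y - (augmentation G (x + y) : ℤ) =
        x - (augmentation G x : ℤ) + (y - (augmentation G y : ℤ))
      simp only [map_add, Int.cast_add]
      abel

theorem coe_augProj (x : FreeAbelianGroup G) :
    (augProj G x : FreeAbelianGroup G) = x - (augmentation G x : ℤ) := rfl

@[simp]
theorem augProj_coe (x : augIdeal G) : augProj G x = x := by
  ext
  simp [coe_augProj, augmentation_coe]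

@[simp]
theorem augProj_one : augProj G 1 = 0 := by
  ext
  simp [coe_augProj]

theorem augProj_of_one : augProj G (FreeAbelianGroup.of 1) = 0 := by
  rw [FreeAbelianGroup.of_one, augProj_one]

theorem coe_augProj_of (g : G) :
    (augProj G (FreeAbelianGroup.of g) : FreeAbelianGroup G) = FreeAbelianGroup.of g - 1 := by
  simp [coe_augProj]

theorem augProj_of_mul (g h : G) :
    augProj G (FreeAbelianGroup.of (g * h)) =
      augProj G (FreeAbelianGroup.of g) * augProj G (FreeAbelianGroup.of h) +
        augProj G (FreeAbelianGroup.of g) + augProj G (FreeAbelianGroup.of h) := by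
  ext
  simp only [AddMemClass.coe_add, MulMemClass.coe_mul, coe_augProj_of, FreeAbelianGroup.of_mul]
  noncomm_ring

/-- Two additive maps on the augmentation ideal agree if they agree on the elements `g - 1`. -/
theorem augIdeal_hom_ext {M : Type*} [AddCommGroup M] {f f' : augIdeal G →+ M}
    (h : ∀ g, f (augProj G (FreeAbelianGroup.of g)) = f' (augProj G (FreeAbelianGroup.of g))) :
    f = f' := by
  have e : f.comp (augProj G) = f'.comp (augProj G) := FreeAbelianGroup.lift_ext _ _ h
  ext x
  simpa using DFunLike.congr_fun e (x : FreeAbelianGroup G)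

/-- The map induced on augmentation ideals by a group homomorphism. -/
def augIdealMap {H : Type u} [Group H] (f : G →* H) : augIdeal G →ₙ+* augIdeal H where
  toFun x := ⟨FreeAbelianGroup.liftMonoid (FreeAbelianGroup.ofMulHom.comp f) x.1, by
    have e : (augmentation H).comp
        (FreeAbelianGroup.liftMonoid (FreeAbelianGroup.ofMulHom.comp f)) = augmentation G := by
      refine RingHom.coe_addMonoidHom_injective (FreeAbelianGroup.lift_ext _ _ fun g => ?_)
      simp [FreeAbelianGroup.ofMulHom]
    exact (DFunLike.congr_fun e x.1).trans x.2⟩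
  map_zero' := Subtype.ext (map_zero _)
  map_add' x y := Subtype.ext (map_add _ x.1 y.1)
  map_mul' x y := Subtype.ext (map_mul _ x.1 y.1)

theorem coe_augIdealMap {H : Type u} [Group H] (f : G →* H) (x : augIdeal G) :
    (augIdealMap f x : FreeAbelianGroup H) = FreeAbelianGroup.map f x := by
  change FreeAbelianGroup.liftMonoid (FreeAbelianGroup.ofMulHom.comp f) x.1 = _
  rw [FreeAbelianGroup.liftMonoid_coe]
  rfl

@[simp]
theorem augIdealMap_augProj_of {H : Type u} [Group H] (f : G →* H) (g : G) :
    augIdealMap f (augProj G (FreeAbelianGroup.of g)) =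
      augProj H (FreeAbelianGroup.of (f g)) := by
  ext
  rw [coe_augIdealMap, coe_augProj, coe_augProj]
  simp [FreeAbelianGroup.one_def]

theorem augIdealMap_id : augIdealMap (MonoidHom.id G) = NonUnitalRingHom.id _ := by
  ext x
  rw [coe_augIdealMap]
  exact FreeAbelianGroup.map_id_apply _

theorem augIdealMap_comp {H K : Type u} [Group H] [Group K] (f : G →* H) (g : H →* K) :
    augIdealMap (g.comp f) = (augIdealMap g).comp (augIdealMap f) := by
  ext x
  change _ = ((augIdealMap g (augIdealMap f x) : augIdeal K) : FreeAbelianGroup K)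
  rw [coe_augIdealMap, coe_augIdealMap, coe_augIdealMap, MonoidHom.coe_comp]
  exact FreeAbelianGroup.map_comp_apply x.1

/-- The additive map `ℤ[G] → G/[G, G]` which extends the projection of `G`. -/
def toAbelianization (G : Type u) [Group G] :
    FreeAbelianGroup G →+ Additive (Abelianization G) :=
  FreeAbelianGroup.lift fun g => Additive.ofMul (Abelianization.of g)

@[simp]
theorem toAbelianization_of (g : G) :
    toAbelianization G (FreeAbelianGroup.of g) = Additive.ofMul (Abelianization.of g) :=
  FreeAbelianGroup.lift_apply_of _ _

@[simp]
theorem toAbelianization_one : toAbelianization G 1 = 0 := by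
  rw [FreeAbelianGroup.one_def, toAbelianization_of, map_one, ofMul_one]

/-- On group elements this says [gh] = [g] + [h], and both sides are biadditive. It follows that I²
maps to zero. -/
theorem toAbelianization_mul (a b : FreeAbelianGroup G) :
    toAbelianization G (a * b) =
      augmentation G b • toAbelianization G a + augmentation G a • toAbelianization G b := by
  induction a using FreeAbelianGroup.induction_on with
  | zero => simp
  | of g =>
    induction b using FreeAbelianGroup.induction_on with
    | zero => simp
    | of h => simp
    | neg h ih => simp only [mul_neg, map_neg, ih, neg_smul, smul_neg]; abel
    | add x y hx hy => simp only [mul_add, map_add, hx, hy, add_smul, smul_add]; abel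
  | neg g ih => simp only [neg_mul, map_neg, ih, neg_smul, smul_neg]; abel
  | add x y hx hy => simp only [add_mul, map_add, hx, hy, add_smul, smul_add]; abel

/-- The projection of the augmentation ideal onto the abelianization, `g - 1 ↦ [g]`. -/
def augToAbelianization (G : Type u) [Group G] :
    augIdeal G →+ Additive (Abelianization G) :=
  (toAbelianization G).comp
    (NonUnitalSubringClass.subtype (augIdeal G) : augIdeal G →+ FreeAbelianGroup G)

theorem augToAbelianization_apply (x : augIdeal G) :
    augToAbelianization G x = toAbelianization G x := rfl

@[simp]
theorem augToAbelianization_augProj_of (g : G) :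
    augToAbelianization G (augProj G (FreeAbelianGroup.of g)) =
      Additive.ofMul (Abelianization.of g) := by
  rw [augToAbelianization_apply, coe_augProj_of, map_sub, toAbelianization_of,
    toAbelianization_one, sub_zero]

theorem augToAbelianization_surjective : Function.Surjective (augToAbelianization G) := by
  intro x
  obtain ⟨g, hg⟩ := QuotientGroup.mk_surjective x.toMul
  exact ⟨_, (augToAbelianization_augProj_of g).trans (congrArg Additive.ofMul hg)⟩

theorem augToAbelianization_mul (x y : augIdeal G) : augToAbelianization G (x * y) = 0 := by
  rw [augToAbelianization_apply, MulMemClass.coe_mul, toAbelianization_mul, augmentation_coe,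
    augmentation_coe, zero_smul, zero_smul, add_zero]

/-! ### Exactness of the bar complex of the augmentation ideal of a free group -/

open barPow

/-- The action of a nonunital ring `R` on `(R ⊗ R) × R` by `x(w, v) = (xw + x ⊗ v, 0)`. -/
noncomputable def barAction (R : Type u) [NonUnitalRing R] :
    R →+ AddMonoid.End (barPow R 1 × R) :=
  AddMonoidHom.mk' (fun x =>
    ((act 1 x).comp (AddMonoidHom.fst _ _) +
      ((cons 0 x).comp base).comp (AddMonoidHom.snd _ _)).prod 0) fun x y => by
    refine AddMonoidHom.ext fun n => Prod.ext ?_ (add_zero 0).symm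
    change act 1 (x + y) n.1 + cons 0 (x + y) (base n.2) = act 1 x n.1 + cons 0 x (base n.2) +
      (act 1 y n.1 + cons 0 y (base n.2))
    rw [map_add, map_add, AddMonoidHom.add_apply, AddMonoidHom.add_apply, add_add_add_comm]

theorem barAction_apply {R : Type u} [NonUnitalRing R] (x : R) (n : barPow R 1 × R) :
    barAction R x n = (act 1 x n.1 + cons 0 x (base n.2), 0) := rfl

/-- The second coordinate dies after one application, so x(y(w, v)) = (x(yw + y ⊗ v), 0), where x
multiplies only the first tensor factor. -/
theorem barAction_mul {R : Type u} [NonUnitalRing R] (x y : R) :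
    barAction R (x * y) = barAction R x * barAction R y := by
  ext n : 1
  change _ = barAction R x (barAction R y n)
  simp [barAction_apply, act_mul]

/-- The action of `G` on `(I ⊗ I) × I` which extends the action of the augmentation ideal `I`. -/
noncomputable def barGroupAction (G : Type u) [Group G] :
    G →* AddMonoid.End (barPow (augIdeal G) 1 × augIdeal G) where
  toFun g := barAction _ (augProj G (FreeAbelianGroup.of g)) + 1
  map_one' := by rw [augProj_of_one, map_zero, zero_add]
  map_mul' g h := by
    rw [augProj_of_mul, map_add, map_add, barAction_mul]
    noncomm_ring

theorem barGroupAction_apply (g : G) (n : barPow (augIdeal G) 1 × augIdeal G) :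
    barGroupAction G g n = barAction _ (augProj G (FreeAbelianGroup.of g)) n + n := rfl

/-- The data on a free group which contract its bar complex: `(σ, l)` comes from the crossed
homomorphism which sends each generator `g` to `(0, g - 1)`. -/
theorem exists_bar_contraction [IsFreeGroup G] :
    ∃ (σ : augIdeal G →+ barPow (augIdeal G) 1) (l : augIdeal G →+ augIdeal G),
      (∀ x, d 0 (σ x) = base (x - l x)) ∧
      (∀ x y, σ (x * y) = act 1 x (σ y) + cons 0 x (base (l y))) ∧
      ∀ x, augToAbelianization G x = 0 → l x = 0 := by
  obtain ⟨D, hD, hb⟩ := IsFreeGroup.exists_crossedHom (barGroupAction G)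
    fun j => (0, augProj G (FreeAbelianGroup.of (IsFreeGroup.of j)))
  have hD1 : D 1 = 0 := by simpa using hD 1 1
  let E : augIdeal G →+ barPow (augIdeal G) 1 × augIdeal G :=
    (FreeAbelianGroup.lift D).comp
      (NonUnitalSubringClass.subtype (augIdeal G) : augIdeal G →+ FreeAbelianGroup G)
  have hE (g : G) : E (augProj G (FreeAbelianGroup.of g)) = D g := by
    change FreeAbelianGroup.lift D (augProj G (FreeAbelianGroup.of g) : FreeAbelianGroup G) = _
    rw [coe_augProj_of, map_sub, FreeAbelianGroup.one_def]
    simp [hD1]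
  -- `E` is linear over I. By additivity it suffices to take x = g - 1 and y = h - 1; as xy = (gh -
  -- 1) - (g - 1) - (h - 1), the claim is the crossed-homomorphism identity for `D`.
  have hmul (x y : augIdeal G) : E (x * y) = barAction _ x (E y) := by
    suffices h : ∀ x : augIdeal G, E.comp (AddMonoidHom.mulLeft x) = (barAction _ x).comp E from
      DFunLike.congr_fun (h x) y
    intro x
    refine augIdeal_hom_ext fun h => ?_
    suffices h' : E.comp (AddMonoidHom.mulRight (augProj G (FreeAbelianGroup.of h))) =
        (barAction (augIdeal G)).flip (D h) by
      exact (DFunLike.congr_fun h' x).trans (congrArg (barAction (augIdeal G) x) (hE h).symm)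
    refine augIdeal_hom_ext fun g => ?_
    have e := augProj_of_mul g h
    rw [add_assoc, ← sub_eq_iff_eq_add] at e
    change E (augProj G (FreeAbelianGroup.of g) * augProj G (FreeAbelianGroup.of h)) =
      barAction _ (augProj G (FreeAbelianGroup.of g)) (D h)
    simp only [← e, hE, hD, barGroupAction_apply, map_sub, map_add]
    abel
  -- The action on (I ⊗ I) × I is chosen to make μ(w, v) = d(w) + v linear. Once μ ∘ E is known to
  -- be the identity, its components σ and l satisfy dσ(x) = x - l(x).
  let μ : barPow (augIdeal G) 1 × augIdeal G →+ barPow (augIdeal G) 0 := (d 0).coprod base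
  have hμ (x : augIdeal G) (n) : μ (barAction _ x n) = act 0 x (μ n) := by
    simp [μ, barAction_apply, d_act]
  -- Both g ↦ μ(D g) and g ↦ g - 1 are crossed homomorphisms, so they agree on a subgroup; it
  -- contains the generators because D(g) = (0, g - 1) there.
  have hμD (g : G) : μ (D g) = base (augProj G (FreeAbelianGroup.of g)) := by
    let S : Subgroup G :=
      { carrier := {g | μ (D g) = base (augProj G (FreeAbelianGroup.of g))}
        one_mem' := by
          change μ (D 1) = base (augProj G (FreeAbelianGroup.of 1))
          rw [hD1, augProj_of_one, map_zero, map_zero]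
        mul_mem' {g h} hg hh := by
          change μ (D (g * h)) = base (augProj G (FreeAbelianGroup.of (g * h)))
          rw [hD, barGroupAction_apply, map_add, map_add, hμ, hg, hh, augProj_of_mul, act_base,
            map_add, map_add]
          abel
        inv_mem' {g} hg := by
          change μ (D g⁻¹) = base (augProj G (FreeAbelianGroup.of g⁻¹))
          have e := congrArg μ (hD g⁻¹ g)
          have e' := congrArg base (augProj_of_mul g⁻¹ g)
          rw [barGroupAction_apply, map_add, map_add, hμ, hg, act_base, inv_mul_cancel, hD1,
            map_zero] at e
          rw [inv_mul_cancel, augProj_of_one, map_zero, map_add, map_add] at e'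
          exact add_right_cancel (add_right_cancel (by rw [add_assoc, ← e, e']; abel)) }
    refine IsFreeGroup.mem_subgroup_of_forall_of_mem S (fun j => ?_) g
    change μ (D _) = _
    simp [hb, μ]
  have hμE (x : augIdeal G) : μ (E x) = base x := by
    suffices h : μ.comp E = base from DFunLike.congr_fun h x
    refine augIdeal_hom_ext fun g => ?_
    rw [AddMonoidHom.comp_apply, hE, hμD]
  refine ⟨(AddMonoidHom.fst _ _).comp E, (AddMonoidHom.snd _ _).comp E, fun x => ?_,
    fun x y => congrArg Prod.fst (hmul x y), fun x hx => ?_⟩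
  · rw [map_sub, ← hμE]
    simp [μ]
  -- I annihilates the second coordinate, so there `D` is an ordinary homomorphism to an abelian
  -- group; hence l factors through G/[G, G].
  · let L : G →* Multiplicative (augIdeal G) :=
      MonoidHom.mk' (fun g => Multiplicative.ofAdd (D g).2) fun g h => by
        rw [hD, barGroupAction_apply, barAction_apply, ← ofAdd_add]
        simp
    suffices h : (AddMonoidHom.snd _ _).comp E =
        (Abelianization.lift L).toAdditiveLeft.comp (augToAbelianization G) by
      rw [h, AddMonoidHom.comp_apply, hx, map_zero]
    refine augIdeal_hom_ext fun g => ?_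
    rw [AddMonoidHom.comp_apply, hE, AddMonoidHom.comp_apply, augToAbelianization_augProj_of]
    rfl

theorem exists_d_eq_of_isFreeGroup [IsFreeGroup G] (n : ℕ) (t : barPow (augIdeal G) (n + 1))
    (ht : d n t = 0) : ∃ t', d (n + 1) t' = t := by
  obtain ⟨σ, l, hd, hσ, -⟩ := exists_bar_contraction (G := G)
  exact exists_d_eq hd hσ n t ht

theorem exists_d_zero_eq_of_isFreeGroup [IsFreeGroup G] (x : augIdeal G)
    (hx : augToAbelianization G x = 0) : ∃ t, d 0 t = base x := by
  obtain ⟨σ, l, hd, -, hl⟩ := exists_bar_contraction (G := G)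
  exact ⟨σ x, by rw [hd, hl x hx, sub_zero]⟩

end Augmentation

/-! ### Dimension shifting along a projective resolution -/

section Resolution

variable {C : Type*} [Category C] [Abelian C] [HasExt C]

/-- If `⋯ ⟶ X 1 ⟶ X 0 ⟶ Y ⟶ 0` is a projective resolution and there is no nonzero morphism
`X i ⟶ F`, then `Extⁱ(Y, F) = 0`. -/
theorem subsingleton_ext_of_projective_resolution (F : C) (i : ℕ) (X : ℕ → C) (Y : C)
    (d : ∀ n, X (n + 1) ⟶ X n) (p : X 0 ⟶ Y) [Epi p] (hX : ∀ n, Projective (X n))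
    (w : d 0 ≫ p = 0) (hp : (ShortComplex.mk _ _ w).Exact)
    (wd : ∀ n, d (n + 1) ≫ d n = 0) (hd : ∀ n, (ShortComplex.mk _ _ (wd n)).Exact)
    (hF : ∀ f : X i ⟶ F, f = 0) : Subsingleton (Abelian.Ext Y F i) := by
  induction i generalizing X Y with
  | zero =>
    rw [Abelian.Ext.homEquiv₀.subsingleton_congr]
    refine subsingleton_of_forall_eq 0 fun f => ?_
    rw [← cancel_epi p, hF (p ≫ f), Limits.comp_zero]
  | succ i ih =>
    -- The shifted complex resolves `kernel p`, and its i-th term is X (i + 1), so `hF` applies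
    -- unchanged.
    let q : X 1 ⟶ Limits.kernel p := Limits.kernel.lift p (d 0) w
    have : Epi q := hp.epi_kernelLift
    have hq : q ≫ Limits.kernel.ι p = d 0 := Limits.kernel.lift_ι _ _ _
    have wq : d 1 ≫ q = 0 := by
      rw [← cancel_mono (Limits.kernel.ι p), Category.assoc, hq, wd, Limits.zero_comp]
    have hex : (ShortComplex.mk _ _ wq).Exact := by
      let φ : ShortComplex.mk _ _ wq ⟶ ShortComplex.mk _ _ (wd 0) :=
        { τ₁ := 𝟙 _, τ₂ := 𝟙 _, τ₃ := Limits.kernel.ι p }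
      exact (ShortComplex.exact_iff_of_epi_of_isIso_of_mono φ).2 (hd 0)
    have := ih (fun n => X (n + 1)) (Limits.kernel p) (fun n => d (n + 1)) q (fun n => hX _) wq
      hex (fun n => wd _) (fun n => hd _) hF
    have hS : (ShortComplex.mk _ _ (Limits.kernel.condition p)).ShortExact :=
      { exact := ShortComplex.exact_kernel p }
    have := hX 0
    refine subsingleton_of_forall_eq 0 fun x => ?_
    -- Projectivity of X 0 makes the connecting map Extⁱ(ker p, F) → Extⁱ⁺¹(Y, F) surjective.
    obtain ⟨y, rfl⟩ := Abelian.Ext.contravariant_sequence_exact₃ hS F x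
      (Abelian.Ext.eq_zero_of_projective _) (add_comm 1 i)
    rw [Subsingleton.elim y 0, Abelian.Ext.comp_zero]

end Resolution

/-! ### Exactness and epimorphisms in `F(gr; ℤ)` -/

/-- Evaluation at an object preserves homology, and a functor is zero when all its values are. -/
theorem exact_of_forall_exact {S : ShortComplex FunctorsOnGr.{u}}
    (h : ∀ (G : Gr.{u}) (x : S.X₂.obj G), S.g.app G x = 0 → ∃ y, S.f.app G y = x) :
    S.Exact := by
  rw [ShortComplex.exact_iff_isZero_homology]
  refine Functor.isZero _ fun G => ?_
  let e := (evaluation Gr.{u} AddCommGrpCat.{u}).obj G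
  refine Limits.IsZero.of_iso ?_ (S.mapHomologyIso e).symm
  rw [← ShortComplex.exact_iff_isZero_homology, ShortComplex.ab_exact_iff]
  exact h G

theorem epi_of_forall_surjective {F F' : FunctorsOnGr.{u}} (f : F ⟶ F')
    (h : ∀ G, Function.Surjective (f.app G)) : Epi f := by
  rw [NatTrans.epi_iff_epi_app]
  exact fun G => (AddCommGrpCat.epi_iff_surjective _).2 (h G)

theorem surjective_of_epi {F F' : FunctorsOnGr.{u}} (f : F ⟶ F') [Epi f] (G : Gr.{u}) :
    Function.Surjective (f.app G) :=
  (AddCommGrpCat.epi_iff_surjective _).1 ((NatTrans.epi_iff_epi_app f).1 inferInstance G)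

/-! ### The projective functors `G ↦ ℤ[Gⁿ]` -/

/-- The infinite cyclic group, as an object of `gr`. -/
def cyclicGr : Gr.{u} where
  obj := GrpCat.of (FreeGroup PUnit.{u + 1})
  property := ⟨inferInstanceAs (IsFreeGroup (FreeGroup PUnit)),
    inferInstanceAs (Group.FG (FreeGroup PUnit))⟩

/-- The free group of rank `n`, as an iterated free product of infinite cyclic groups. -/
abbrev freeGr (n : ℕ) : Gr.{u} := freeProd fun _ : Fin n => cyclicGr.{u}

/-- The free generators of the free group of rank `n`. -/
def freeGrGen (n : ℕ) (i : Fin n) : (freeGr.{u} n).obj :=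
  (freeProdIncl (fun _ : Fin n => cyclicGr.{u}) i).hom.hom (FreeGroup.of PUnit.unit)

/-- The homomorphism from the free group of rank `n` given by a tuple of elements. -/
def freeGrDesc {n : ℕ} {G : Gr.{u}} (v : Fin n → G.obj) : freeGr.{u} n ⟶ G :=
  freeProdDesc fun i =>
    ObjectProperty.homMk (GrpCat.ofHom (FreeGroup.lift fun _ : PUnit => v i))

theorem freeGrDesc_gen {n : ℕ} {G : Gr.{u}} (v : Fin n → G.obj) (i : Fin n) :
    (freeGrDesc v).hom.hom (freeGrGen n i) = v i := by
  have e := congrArg (fun φ => φ.hom.hom (FreeGroup.of PUnit.unit)) (freeProdIncl_desc (fun i =>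
    (ObjectProperty.homMk (GrpCat.ofHom (FreeGroup.lift fun _ : PUnit => v i)) :
      cyclicGr.{u} ⟶ G)) i)
  exact e.trans FreeGroup.lift_apply_of

theorem cyclicGr_hom_ext {G : Gr.{u}} {f g : cyclicGr.{u} ⟶ G}
    (h : f.hom.hom (FreeGroup.of PUnit.unit) = g.hom.hom (FreeGroup.of PUnit.unit)) : f = g := by
  apply ObjectProperty.hom_ext
  apply GrpCat.hom_ext
  exact FreeGroup.ext_hom _ _ fun _ => h

theorem freeGr_hom_ext {n : ℕ} {G : Gr.{u}} {f g : freeGr.{u} n ⟶ G}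
    (h : ∀ i, f.hom.hom (freeGrGen n i) = g.hom.hom (freeGrGen n i)) : f = g :=
  freeProd_hom_ext fun i => cyclicGr_hom_ext (h i)

/-- The functor `G ↦ ℤ[Gⁿ]`. -/
def tupleFunctor (n : ℕ) : FunctorsOnGr.{u} where
  obj G := AddCommGrpCat.of (FreeAbelianGroup (Fin n → G.obj))
  map f := AddCommGrpCat.ofHom (FreeAbelianGroup.map fun v i => f.hom.hom (v i))
  map_id G := by
    ext : 1
    exact FreeAbelianGroup.map_id
  map_comp f g := by
    ext : 1
    exact FreeAbelianGroup.lift_ext _ _ fun v => by simp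

/-- The morphism `ℤ[Gⁿ] ⟶ F` determined by an element of `F` at the free group of rank `n`. -/
def tupleFunctorDesc {n : ℕ} (F : FunctorsOnGr.{u}) (y : F.obj (freeGr.{u} n)) :
    tupleFunctor.{u} n ⟶ F where
  app G := AddCommGrpCat.ofHom (FreeAbelianGroup.lift fun v => F.map (freeGrDesc v) y)
  naturality G H f := by
    ext : 1
    refine FreeAbelianGroup.lift_ext _ _ fun v => ?_
    have e : freeGrDesc (fun i => f.hom.hom (v i)) = freeGrDesc v ≫ f :=
      freeGr_hom_ext fun i => by
        rw [freeGrDesc_gen]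
        exact congrArg f.hom.hom (freeGrDesc_gen v i).symm
    simp [tupleFunctor, e]

/-- Yoneda: every tuple in G is the image of the universal tuple of free generators. -/
theorem tupleFunctor_hom_apply {n : ℕ} {F : FunctorsOnGr.{u}} (f : tupleFunctor.{u} n ⟶ F)
    {G : Gr.{u}} (v : Fin n → G.obj) :
    f.app G (FreeAbelianGroup.of v) =
      F.map (freeGrDesc v) (f.app (freeGr n) (FreeAbelianGroup.of (freeGrGen n))) := by
  have e := congrArg (fun φ => φ.hom (FreeAbelianGroup.of (freeGrGen n)))
    (f.naturality (freeGrDesc v))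
  refine Eq.trans ?_ e
  refine congrArg (f.app G) ?_
  refine Eq.trans ?_ (FreeAbelianGroup.map_of_apply _).symm
  exact congrArg _ (funext fun i => (freeGrDesc_gen v i).symm)

theorem tupleFunctor_hom_ext {n : ℕ} {F : FunctorsOnGr.{u}} {f g : tupleFunctor.{u} n ⟶ F}
    (h : f.app (freeGr n) (FreeAbelianGroup.of (freeGrGen n)) =
      g.app (freeGr n) (FreeAbelianGroup.of (freeGrGen n))) : f = g := by
  ext G : 3
  exact FreeAbelianGroup.lift_ext _ _ fun v =>
    (tupleFunctor_hom_apply f v).trans ((congrArg _ h).trans (tupleFunctor_hom_apply g v).symm)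

/-- Hom(ℤ[Gⁿ], F) is the value of F on the free group of rank n, and epimorphisms of functors are
surjective on values. -/
instance projective_tupleFunctor (n : ℕ) : Projective (tupleFunctor.{u} n) where
  factors {E X} f e _ := by
    obtain ⟨y, hy⟩ := surjective_of_epi e (freeGr n)
      (f.app (freeGr n) (FreeAbelianGroup.of (freeGrGen n)))
    refine ⟨tupleFunctorDesc E y, tupleFunctor_hom_ext ?_⟩
    refine Eq.trans ?_ hy
    refine congrArg (e.app (freeGr n)) ?_
    refine (FreeAbelianGroup.lift_apply_of _ _).trans ?_
    have : freeGrDesc (freeGrGen n) = 𝟙 (freeGr.{u} n) :=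
      freeGr_hom_ext fun i => freeGrDesc_gen _ i
    rw [this]
    simp

/-! ### The bar resolution of the abelianization functor -/

/-- The functor `G ↦ I(G) ⊗ ⋯ ⊗ I(G)` with `n + 1` factors. -/
noncomputable def barFunctor (n : ℕ) : FunctorsOnGr.{u} where
  obj G := barPow (augIdeal G.obj) n
  map f := AddCommGrpCat.ofHom (barPow.map (augIdealMap f.hom.hom) n)
  map_id G := by
    ext : 1
    exact (congrArg (barPow.map · n) augIdealMap_id).trans (barPow.map_id n)
  map_comp f g := by
    ext : 1
    exact (congrArg (barPow.map · n) (augIdealMap_comp f.hom.hom g.hom.hom)).trans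
      (barPow.map_comp _ _ n)

/-- The differential of the bar resolution. -/
noncomputable def barFunctorD (n : ℕ) : barFunctor.{u} (n + 1) ⟶ barFunctor.{u} n where
  app G := AddCommGrpCat.ofHom (barPow.d n)
  naturality G H f := by
    ext t
    exact (barPow.map_d (augIdealMap f.hom.hom) n t).symm

/-- The augmentation of the bar resolution. -/
noncomputable def barFunctorAug : barFunctor.{u} 0 ⟶ abelianizationFunctor.{u} where
  app G := AddCommGrpCat.ofHom (augToAbelianization G.obj)
  naturality G H f := by
    ext : 1
    refine augIdeal_hom_ext fun g => ?_
    change augToAbelianization H.obj (augIdealMap f.hom.hom (augProj G.obj (.of g))) =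
      (GrpCat.abelianize.map f.hom).hom.toAdditive
        (augToAbelianization G.obj (augProj G.obj (.of g)))
    rw [augIdealMap_augProj_of, augToAbelianization_augProj_of, augToAbelianization_augProj_of]
    rfl

instance epi_barFunctorAug : Epi barFunctorAug.{u} :=
  epi_of_forall_surjective _ fun _ => augToAbelianization_surjective

theorem barFunctorD_comp (n : ℕ) :
    barFunctorD.{u} (n + 1) ≫ barFunctorD n = 0 := by
  ext G : 3
  exact barPow.d_comp_d n

theorem barFunctorD_comp_aug : barFunctorD.{u} 0 ≫ barFunctorAug = 0 := by
  ext G : 3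
  exact barPow.hom_ext fun x t => augToAbelianization_mul x t

theorem exact_barFunctorD (n : ℕ) : (ShortComplex.mk _ _ (barFunctorD_comp.{u} n)).Exact :=
  exact_of_forall_exact fun G t ht => by
    have := G.property.1
    exact exists_d_eq_of_isFreeGroup (G := G.obj) n t ht

theorem exact_barFunctorAug : (ShortComplex.mk _ _ barFunctorD_comp_aug.{u}).Exact :=
  exact_of_forall_exact fun G t ht => by
    have := G.property.1
    exact exists_d_zero_eq_of_isFreeGroup (G := G.obj) t ht

/-! ### The bar resolution is projective -/

namespace barPow

variable {G : Type u} [Group G]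

/-- The tensor `(g₀ - 1) ⊗ ⋯ ⊗ (gₙ - 1)`. -/
noncomputable def ofTuple : ∀ n : ℕ, (Fin (n + 1) → G) → barPow (augIdeal G) n
  | 0, v => base (augProj G (FreeAbelianGroup.of (v 0)))
  | n + 1, v => cons n (augProj G (FreeAbelianGroup.of (v 0))) (ofTuple n (Fin.tail v))

theorem ofTuple_eq_zero (n : ℕ) (v : Fin (n + 1) → G) (i : Fin (n + 1)) (h : v i = 1) :
    ofTuple n v = 0 := by
  induction n with
  | zero =>
    obtain rfl : i = 0 := Fin.fin_one_eq_zero i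
    rw [ofTuple, h, augProj_of_one, map_zero]
  | succ n ih =>
    rw [ofTuple]
    cases i using Fin.cases with
    | zero => rw [h, augProj_of_one, map_zero, AddMonoidHom.zero_apply]
    | succ i => rw [ih (Fin.tail v) i h, map_zero]

theorem map_ofTuple {H : Type u} [Group H] (f : G →* H) (n : ℕ) (v : Fin (n + 1) → G) :
    map (augIdealMap f) n (ofTuple n v) = ofTuple n fun i => f (v i) := by
  induction n with
  | zero => simp [ofTuple]
  | succ n ih =>
    simp only [ofTuple, map_cons, ih, augIdealMap_augProj_of]
    rfl

/-- The additive map `g, v ↦ (g, v)`. -/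
noncomputable def consTuple (n : ℕ) : FreeAbelianGroup G →+
    FreeAbelianGroup (Fin n → G) →+ FreeAbelianGroup (Fin (n + 1) → G) :=
  FreeAbelianGroup.lift fun g => FreeAbelianGroup.map (Fin.cons (α := fun _ => G) g)

@[simp]
theorem consTuple_of (n : ℕ) (g : G) (v : Fin n → G) :
    consTuple n (FreeAbelianGroup.of g) (FreeAbelianGroup.of v) =
      FreeAbelianGroup.of (Fin.cons (α := fun _ => G) g v) := by
  simp [consTuple]

theorem map_consTuple {H : Type u} [Group H] (f : G →* H) (n : ℕ) (x : FreeAbelianGroup G)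
    (t : FreeAbelianGroup (Fin n → G)) :
    FreeAbelianGroup.map (fun v i => f (v i)) (consTuple n x t) =
      consTuple n (FreeAbelianGroup.map f x) (FreeAbelianGroup.map (fun v i => f (v i)) t) := by
  induction x using FreeAbelianGroup.induction_on with
  | zero => simp
  | of g =>
    induction t using FreeAbelianGroup.induction_on with
    | zero => simp
    | of v =>
      simp only [consTuple_of, FreeAbelianGroup.map_of_apply]
      congr 1
      ext i
      cases i using Fin.cases <;> rfl
    | neg v ih => simp only [map_neg, ih]
    | add s t hs ht => simp only [map_add, hs, ht]
  | neg g ih => simp only [map_neg, AddMonoidHom.neg_apply, ih]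
  | add x y hx hy => simp only [map_add, AddMonoidHom.add_apply, hx, hy]

/-- The inclusion of a tensor power of the augmentation ideal in `ℤ[Gⁿ⁺¹]`. -/
noncomputable def toTuples : ∀ n : ℕ,
    barPow (augIdeal G) n →+ FreeAbelianGroup (Fin (n + 1) → G)
  | 0 => (FreeAbelianGroup.map fun g _ => g).comp
      (NonUnitalSubringClass.subtype (augIdeal G) : augIdeal G →+ FreeAbelianGroup G)
  | n + 1 => lift ((AddMonoidHom.compHom.flip (toTuples n)).comp ((consTuple (n + 1)).comp
      (NonUnitalSubringClass.subtype (augIdeal G) : augIdeal G →+ FreeAbelianGroup G)))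

theorem toTuples_base (x : augIdeal G) :
    toTuples 0 (base x) = FreeAbelianGroup.map (fun g _ => g) (x : FreeAbelianGroup G) := rfl

theorem toTuples_cons (n : ℕ) (x : augIdeal G) (t : barPow (augIdeal G) n) :
    toTuples (n + 1) (cons n x t) = consTuple (n + 1) (x : FreeAbelianGroup G) (toTuples n t) :=
  rfl

theorem map_toTuples {H : Type u} [Group H] (f : G →* H) (n : ℕ) (t : barPow (augIdeal G) n) :
    toTuples n (map (augIdealMap f) n t) =
      FreeAbelianGroup.map (fun v i => f (v i)) (toTuples n t) := by
  suffices h : (toTuples n).comp (map (augIdealMap f) n) =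
      (FreeAbelianGroup.map fun v i => f (v i)).comp (toTuples n) from DFunLike.congr_fun h t
  clear t
  induction n with
  | zero =>
    refine base_hom_ext fun x => ?_
    simp only [AddMonoidHom.comp_apply, map_base, toTuples_base, coe_augIdealMap,
      ← FreeAbelianGroup.map_comp_apply]
    rfl
  | succ n ih =>
    refine hom_ext fun x t => ?_
    have := DFunLike.congr_fun ih t
    simp only [AddMonoidHom.comp_apply] at this
    simp only [AddMonoidHom.comp_apply, map_cons, toTuples_cons, this, map_consTuple,
      coe_augIdealMap]

theorem lift_ofTuple_consTuple (n : ℕ) (x : FreeAbelianGroup G)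
    (t : FreeAbelianGroup (Fin (n + 1) → G)) :
    FreeAbelianGroup.lift (ofTuple (n + 1)) (consTuple (n + 1) x t) =
      cons n (augProj G x) (FreeAbelianGroup.lift (ofTuple n) t) := by
  induction x using FreeAbelianGroup.induction_on with
  | zero => simp
  | of g =>
    induction t using FreeAbelianGroup.induction_on with
    | zero => simp
    | of v => simp [ofTuple]
    | neg v ih => simp only [map_neg, ih]
    | add s t hs ht => simp only [map_add, hs, ht]
  | neg g ih => simp only [map_neg, AddMonoidHom.neg_apply, ih]
  | add x y hx hy => simp only [map_add, AddMonoidHom.add_apply, hx, hy]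

/-- Under ℤ[Gⁿ⁺¹] = ℤ[G]^{⊗(n+1)}, the retraction is x ↦ x - ε(x) on each factor, which fixes I. -/
theorem lift_ofTuple_toTuples (n : ℕ) (t : barPow (augIdeal G) n) :
    FreeAbelianGroup.lift (ofTuple n) (toTuples n t) = t := by
  suffices h : (FreeAbelianGroup.lift (ofTuple n)).comp (toTuples n) =
      AddMonoidHom.id (barPow (augIdeal G) n) from DFunLike.congr_fun h t
  clear t
  induction n with
  | zero =>
    suffices h : (FreeAbelianGroup.lift (ofTuple 0)).comp (FreeAbelianGroup.map fun g _ => g) =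
        (base (R := augIdeal G)).comp (augProj G) from base_hom_ext fun x =>
      (DFunLike.congr_fun h (x : FreeAbelianGroup G)).trans
        (congrArg (base (R := augIdeal G)) (augProj_coe x))
    refine FreeAbelianGroup.lift_ext _ _ fun g => ?_
    rw [AddMonoidHom.comp_apply, FreeAbelianGroup.map_of_apply, FreeAbelianGroup.lift_apply_of]
    rfl
  | succ n ih =>
    refine hom_ext fun x t => ?_
    have := DFunLike.congr_fun ih t
    simp only [AddMonoidHom.comp_apply] at this
    simp only [AddMonoidHom.comp_apply, toTuples_cons, lift_ofTuple_consTuple, this, augProj_coe]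
    rfl

end barPow

/-- The functor `G ↦ I(G) ⊗ ⋯ ⊗ I(G)` is a retract of `G ↦ ℤ[Gⁿ⁺¹]`. -/
noncomputable def retractBarFunctor (n : ℕ) :
    Retract (barFunctor.{u} n) (tupleFunctor.{u} (n + 1)) where
  i :=
    { app := fun G => AddCommGrpCat.ofHom (barPow.toTuples n)
      naturality := fun G H f => by
        ext t
        exact barPow.map_toTuples f.hom.hom n t }
  r :=
    { app := fun G => AddCommGrpCat.ofHom (FreeAbelianGroup.lift (barPow.ofTuple n))
      naturality := fun G H f => by
        ext : 1
        refine FreeAbelianGroup.lift_ext _ _ fun v => ?_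
        change FreeAbelianGroup.lift (barPow.ofTuple n)
            (FreeAbelianGroup.map (fun v i => f.hom.hom (v i)) (FreeAbelianGroup.of v)) =
          barPow.map (augIdealMap f.hom.hom) n
            (FreeAbelianGroup.lift (barPow.ofTuple n) (FreeAbelianGroup.of v))
        rw [FreeAbelianGroup.map_of_apply, FreeAbelianGroup.lift_apply_of,
          FreeAbelianGroup.lift_apply_of, barPow.map_ofTuple] }
  retract := by
    ext G t
    exact barPow.lift_ofTuple_toTuples n t

theorem projective_barFunctor (n : ℕ) : Projective (barFunctor.{u} n) :=
  (retractBarFunctor n).projective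

/-! ### Cross-effects -/

theorem crossEffectSubgroup_eq_zero_of_isZero {F : FunctorsOnGr.{u}} {n : ℕ}
    (h : Limits.IsZero (crossEffect F n)) {G : Fin n → Gr.{u}} {x : F.obj (freeProd G)}
    (hx : x ∈ crossEffectSubgroup F G) : x = 0 := by
  have : Subsingleton (crossEffectSubgroup F G) :=
    AddCommGrpCat.subsingleton_of_isZero (h.obj G)
  exact congrArg Subtype.val (Subsingleton.elim (α := crossEffectSubgroup F G) ⟨x, hx⟩ 0)

/-- Elements of the cross-effect are killed by all homomorphisms which are trivial on one of the
free factors. -/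
theorem map_eq_zero_of_mem_crossEffectSubgroup {F : FunctorsOnGr.{u}} {n : ℕ}
    {G : Fin n → Gr.{u}} {x : F.obj (freeProd G)} (hx : x ∈ crossEffectSubgroup F G)
    {K : Gr.{u}} (f : freeProd G ⟶ K) (i : Fin n)
    (hf : freeProdIncl G i ≫ f = trivialHom _ _) : F.map f x = 0 := by
  have e : freeProdOmit G i ≫ freeProdDesc (fun j : {j : Fin n // j ≠ i} =>
      freeProdIncl G j ≫ f) = f := by
    refine freeProd_hom_ext fun j => ?_
    rw [← Category.assoc, freeProdOmit, freeProdIncl_desc]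
    by_cases h : j = i
    · subst h
      rw [dif_pos rfl, trivialHom_comp, hf]
    · rw [dif_neg h, freeProdIncl_desc]
  have hi : F.map (freeProdOmit G i) x = 0 := congrFun hx i
  rw [← e, F.map_comp, AddCommGrpCat.comp_apply, hi, map_zero]

/-- Grouping the free factors along the fibres of σ carries an m-fold cross-effect injectively into
an n-fold one. Thus vanishing of one cross-effect passes to all higher ones without induction. -/
theorem crossEffectSubgroup_eq_zero_of_surjective {F : FunctorsOnGr.{u}} {m n : ℕ}
    (h : Limits.IsZero (crossEffect F n)) (σ : Fin m → Fin n) (hσ : Function.Surjective σ)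
    {G : Fin m → Gr.{u}} {x : F.obj (freeProd G)} (hx : x ∈ crossEffectSubgroup F G) :
    x = 0 := by
  let H : Fin n → Gr.{u} := fun j => freeProd fun i : {i : Fin m // σ i = j} => G i
  let θ : freeProd G ⟶ freeProd H := freeProdDesc fun i =>
    freeProdIncl (fun k : {k : Fin m // σ k = σ i} => G k) ⟨i, rfl⟩ ≫ freeProdIncl H (σ i)
  let ρ : freeProd H ⟶ freeProd G := freeProdDesc fun j => freeProdDesc fun i => freeProdIncl G i
  have hθ (i : Fin m) : freeProdIncl G i ≫ θ =
      freeProdIncl (fun k : {k : Fin m // σ k = σ i} => G k) ⟨i, rfl⟩ ≫ freeProdIncl H (σ i) :=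
    freeProdIncl_desc _ _
  have hθρ : θ ≫ ρ = 𝟙 _ := by
    refine freeProd_hom_ext fun i => ?_
    rw [← Category.assoc, hθ, Category.assoc, freeProdIncl_desc, freeProdIncl_desc,
      Category.comp_id]
  -- Fibres of σ are nonempty, so omitting the j-th group kills at least one original factor `G i`,
  -- and hence x.
  have hmem : F.map θ x ∈ crossEffectSubgroup F H := by
    funext j
    obtain ⟨i, rfl⟩ := hσ j
    change F.map (freeProdOmit H (σ i)) (F.map θ x) = 0
    rw [← AddCommGrpCat.comp_apply, ← F.map_comp]
    refine map_eq_zero_of_mem_crossEffectSubgroup hx _ i ?_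
    rw [← Category.assoc, hθ, Category.assoc, freeProdOmit, freeProdIncl_desc, dif_pos rfl,
      comp_trivialHom]
  have e : F.map ρ (F.map θ x) = x := by
    rw [← AddCommGrpCat.comp_apply, ← F.map_comp, hθρ]
    simp
  rw [← e, crossEffectSubgroup_eq_zero_of_isZero h hmem, map_zero]

theorem barFunctor_hom_eq_zero {F : FunctorsOnGr.{u}} {d i : ℕ}
    (h : Limits.IsZero (crossEffect F (d + 1))) (hi : d ≤ i) (f : barFunctor.{u} i ⟶ F) :
    f = 0 := by
  -- The retraction is a split epimorphism, so f may be replaced by a morphism out of ℤ[Gⁱ⁺¹], which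
  -- is determined by its value on the universal tuple.
  suffices hr : (retractBarFunctor i).r ≫ f = 0 by
    rw [← Category.id_comp f, ← (retractBarFunctor i).retract, Category.assoc, hr,
      Limits.comp_zero]
  refine tupleFunctor_hom_ext ?_
  -- Truncation at d maps the i + 1 cyclic factors onto d + 1 groups; this is where d ≤ i enters.
  refine crossEffectSubgroup_eq_zero_of_surjective h
    (fun j : Fin (i + 1) => ⟨min j d, by omega⟩) (fun j => ⟨⟨j, by omega⟩, ?_⟩) ?_
  · ext
    change min (j : ℕ) d = j
    omega
  · funext j
    -- Omitting the j-th factor sends the universal tuple to `v`, whose j-th entry is 1, so the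
    -- corresponding tensor vanishes.
    let v : Fin (i + 1) → (freeProd fun k : {k : Fin (i + 1) // k ≠ j} => cyclicGr.{u}).obj :=
      fun k => (freeProdOmit (fun _ => cyclicGr) j).hom.hom (freeGrGen (i + 1) k)
    have hv : freeGrDesc v = freeProdOmit (fun _ => cyclicGr) j :=
      freeGr_hom_ext fun k => freeGrDesc_gen v k
    have hvj : v j = 1 := by
      have e := congrArg (fun φ => φ.hom.hom (FreeGroup.of PUnit.unit))
        (freeProdIncl_desc (G := fun _ : Fin (i + 1) => cyclicGr.{u})
          (fun k => if h : k = j then trivialHom _ _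
            else freeProdIncl (fun k : {k : Fin (i + 1) // k ≠ j} => cyclicGr.{u}) ⟨k, h⟩) j)
      refine e.trans ?_
      rw [dif_pos rfl]
      rfl
    change F.map (freeProdOmit (fun _ => cyclicGr) j) _ = 0
    rw [← hv, ← tupleFunctor_hom_apply]
    change f.app _ (FreeAbelianGroup.lift (barPow.ofTuple i) (FreeAbelianGroup.of v)) = 0
    rw [FreeAbelianGroup.lift_apply_of, barPow.ofTuple_eq_zero i v j hvj]
    exact map_zero (f.app _).hom

theorem proposition202508271137 (F : FunctorsOnGr.{u}) (d : ℕ) (hF : IsPolynomialOfDegree F d)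
    (i : ℕ) (hi : d ≤ i) : Subsingleton (Abelian.Ext abelianizationFunctor.{u} F i) :=
  subsingleton_ext_of_projective_resolution F i barFunctor.{u} _ barFunctorD barFunctorAug
    projective_barFunctor barFunctorD_comp_aug exact_barFunctorAug barFunctorD_comp
    exact_barFunctorD fun f => barFunctor_hom_eq_zero hF.1 hi f
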